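/- Let $k \ge 2$ be an integer. For a finite simple graph $G$, let the maximum average degree $\mathrm{mad}(G)$ be the maximum of $\frac{2|E(H)|}{|V(H)|}$ over all subgraphs $H$ of $G$ with at least one vertex (and $0$ if $G$ has no vertices). If $G$ is a finite simple graph with $$\mathrm{mad}(G) < \frac{8k}{3k+1} = \frac{8}{3}\left(1 - \frac{1}{3k+1}\right),$$ then $G$ admits an $(\mathcal{I},\mathcal{O}_k)$-partition; that is, $V(G)$ can be partitioned into two (possibly empty) sets $I$ and $O$ such that $I$ is an independent set of $G$ and every connected component of the induced subgraph $G[O]$ has at most $k$ vertices. -/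

import Mathlib

namespace SimpleGraph

/-- The maximum average degree of `G`: the supremum of `2|E(H)| / |V(H)|` over all subgraphs `H`
of `G` with at least one vertex. For a finite graph the set below is finite, so the supremum is
a maximum (the value is `0` for the graph without vertices). -/
noncomputable def mad {V : Type*} (G : SimpleGraph V) : ℝ :=
  sSup {d : ℝ | ∃ H : G.Subgraph, H.verts.Nonempty ∧
    d = 2 * (H.edgeSet.ncard : ℝ) / (H.verts.ncard : ℝ)}

/-- The class `𝓘` of edgeless graphs. -/
def IsEdgeless {V : Type*} (G : SimpleGraph V) : Prop :=
  ∀ u v : V, ¬ G.Adj u v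

/-- The class `𝓞ₖ` of graphs all of whose components have order at most `k`. -/
def ComponentsOrderLE {V : Type*} (G : SimpleGraph V) (k : ℕ) : Prop :=
  ∀ c : G.ConnectedComponent, c.supp.encard ≤ (k : ℕ∞)

/-- `G` admits an `(𝓘, 𝓞ₖ)`-partition: the vertex set is the disjoint union of two (possibly
empty) sets `I` and `O` with `G[I]` edgeless and every component of `G[O]` of order at most `k`. -/
def AdmitsIOPartition {V : Type*} (G : SimpleGraph V) (k : ℕ) : Prop :=
  ∃ I O : Set V, I ∪ O = Set.univ ∧ Disjoint I O ∧
    (G.induce I).IsEdgeless ∧ (G.induce O).ComponentsOrderLE k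

end SimpleGraph

/-!
Give every vertex `v` a positive weight `w v` and bound the weight, rather than the order, of the
components of `G[O]`. Twice the potential of a set `S` of vertices is
`∑ v ∈ S, (8 k - (k + 3) (w v - 1)) - (3 k + 1) * 2 |E(G[S])|`; for unit weights the bound on `mad`
says that every nonempty set has positive potential. This property suffices for a partition: in a
smallest counterexample a vertex of degree one has weight more than `k`, and so has every set of
vertices whose outer neighbours all have degree two, when taken together with these neighbours.
If `u` and `v` are adjacent vertices of degree two with `w u + w v ≤ k`, delete both and add the
weight of `u` to its other neighbour, so that a partition of the smaller graph leaves room for `u`.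
By minimality this fails only if that neighbour lies in a set of small potential, and likewise for
`v`; by submodularity, the union of both sets with `u` and `v` then has nonpositive potential. Given
these facts, discharging towards the components of the graph of vertices of degree three shows that
the whole graph has nonpositive potential.
-/

namespace WeightedIOPartition

open Finset

variable {V : Type*} {G : SimpleGraph V} [DecidableRel G.Adj] {k : ℕ} {w : V → ℕ}
  {A N P Q S T : Finset V} {f : V → Option ℕ} {u v x z : V}

/-! ### Neighbours in a finite set -/

/-- The neighbours of `v` in `S`. -/
def neighborsIn (G : SimpleGraph V) [DecidableRel G.Adj] (S : Finset V) (v : V) : Finset V :=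
  {b ∈ S | G.Adj v b}

/-- The number of neighbours of `v` in `S`, that is, the degree of `v` in `G[S]` if `v ∈ S`. -/
def degreeIn (G : SimpleGraph V) [DecidableRel G.Adj] (S : Finset V) (v : V) : ℕ :=
  #(neighborsIn G S v)

@[simp]
lemma mem_neighborsIn : x ∈ neighborsIn G S v ↔ x ∈ S ∧ G.Adj v x :=
  mem_filter

lemma neighborsIn_sdiff [DecidableEq V] (S T : Finset V) (v : V) :
    neighborsIn G (S \ T) v = neighborsIn G S v \ T := by
  ext b
  simp only [mem_neighborsIn, mem_sdiff, and_right_comm]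

lemma degreeIn_add_degreeIn_sdiff [DecidableEq V] (h : S ⊆ T) (v : V) :
    degreeIn G S v + degreeIn G (T \ S) v = degreeIn G T v := by
  have sdiff_eq : neighborsIn G (T \ S) v = neighborsIn G T v \ neighborsIn G S v := by
    grind [mem_neighborsIn]
  rw [degreeIn, degreeIn, degreeIn, sdiff_eq, add_comm]
  exact card_sdiff_add_card_eq_card (filter_subset_filter _ h)

lemma exists_neighborsIn_eq_pair [DecidableEq V] (h : degreeIn G S u = 2)
    (hv : v ∈ neighborsIn G S u) :
    ∃ x, x ≠ v ∧ neighborsIn G S u = {v, x} := by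
  obtain ⟨x, hx⟩ : ∃ x, (neighborsIn G S u).erase v = {x} := by
    rw [← card_eq_one, card_erase_of_mem hv, ← degreeIn, h]
  refine ⟨x, ne_of_mem_erase (hx ▸ mem_singleton_self x), ?_⟩
  rw [← insert_erase hv, hx]

lemma sum_interedges {M : Type*} [AddCommMonoid M] (S T : Finset V) (F : V → V → M) :
    ∑ p ∈ G.interedges S T, F p.1 p.2 = ∑ a ∈ S, ∑ b ∈ neighborsIn G T a, F a b := by
  simp only [SimpleGraph.interedges_def, neighborsIn, sum_filter, sum_product]

lemma sum_neighborsIn_comm {M : Type*} [AddCommMonoid M] (S T : Finset V) (F : V → V → M) :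
    ∑ a ∈ S, ∑ b ∈ neighborsIn G T a, F a b = ∑ b ∈ T, ∑ a ∈ neighborsIn G S b, F a b :=
  sum_comm' fun a b => by simp only [mem_neighborsIn, G.adj_comm a b]; tauto

lemma card_interedges_eq_sum_degreeIn (S T : Finset V) :
    #(G.interedges S T) = ∑ a ∈ S, degreeIn G T a := by
  simp only [card_eq_sum_ones, degreeIn, sum_interedges S T fun _ _ => 1]

lemma card_interedges_insert [DecidableEq V] (hu : u ∉ T) :
    #(G.interedges (insert u T) (insert u T)) = #(G.interedges T T) + 2 * degreeIn G T u := by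
  have neighborsIn_self : neighborsIn G (insert u T) u = neighborsIn G T u := by
    simp [neighborsIn, filter_insert]
  have degreeIn_insert (a : V) :
      degreeIn G (insert u T) a = degreeIn G T a + if G.Adj u a then 1 else 0 := by
    simp only [degreeIn, neighborsIn, filter_insert, G.adj_comm u a]
    split_ifs
    · rw [card_insert_of_notMem (by simp [hu])]
    · simp
  have sum_adj : ∑ a ∈ T, (if G.Adj u a then 1 else 0) = degreeIn G T u := by
    rw [← card_filter, degreeIn, neighborsIn]
  rw [card_interedges_eq_sum_degreeIn, sum_insert hu, degreeIn, neighborsIn_self,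
    sum_congr rfl fun a _ => degreeIn_insert a, sum_add_distrib, sum_adj, ← degreeIn,
    ← card_interedges_eq_sum_degreeIn]
  ring

lemma card_interedges_supermodular [DecidableEq V] (S T : Finset V) :
    #(G.interedges S S) + #(G.interedges T T) ≤
      #(G.interedges (S ∪ T) (S ∪ T)) + #(G.interedges (S ∩ T) (S ∩ T)) := by
  have union_subset : G.interedges S S ∪ G.interedges T T ⊆ G.interedges (S ∪ T) (S ∪ T) :=
    union_subset (G.interedges_mono subset_union_left subset_union_left)
      (G.interedges_mono subset_union_right subset_union_right)
  have inter_subset : G.interedges S S ∩ G.interedges T T ⊆ G.interedges (S ∩ T) (S ∩ T) := by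
    intro p
    simp only [mem_inter, SimpleGraph.mem_interedges_iff]
    tauto
  rw [← card_union_add_card_inter]
  gcongr

lemma card_interedges_eq_two_mul_ncard (S : Finset V) :
    #(G.interedges S S) = 2 * (G.induce (S : Set V)).edgeSet.ncard := by
  have degree_eq (a : (S : Set V)) : (G.induce (S : Set V)).degree a = degreeIn G S a := by
    rw [← SimpleGraph.card_neighborFinset_eq_degree, degreeIn,
      ← card_map (Function.Embedding.subtype _)]
    congr 1
    ext b
    simp [and_comm]
  calc #(G.interedges S S)
    _ = ∑ a : (S : Set V), (G.induce (S : Set V)).degree a := by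
      simp only [card_interedges_eq_sum_degreeIn, degree_eq]
      exact (sum_coe_sort S (degreeIn G S)).symm
    _ = 2 * (G.induce (S : Set V)).edgeSet.ncard := by
      rw [SimpleGraph.sum_degrees_eq_twice_card_edges, ← SimpleGraph.coe_edgeFinset,
        Set.ncard_coe_finset]

lemma two_mul_card_le_card_interedges_add_two (h : (G.induce (Q : Set V)).Connected) :
    2 * #Q ≤ #(G.interedges Q Q) + 2 := by
  have card_le := h.card_vert_le_card_edgeSet_add_one
  rw [Nat.card_coe_set_eq, Nat.card_coe_set_eq, Set.ncard_coe_finset] at card_le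
  rw [card_interedges_eq_two_mul_ncard]
  lia

lemma card_interedges_sdiff_le [DecidableEq V] (hQA : Q ⊆ A)
    (hconn : (G.induce (Q : Set V)).Connected) (hdeg : ∀ a ∈ Q, degreeIn G A a = 3) :
    #(G.interedges Q (A \ Q)) ≤ #Q + 2 := by
  have card_add_card : #(G.interedges Q Q) + #(G.interedges Q (A \ Q)) = #Q * 3 := by
    rw [card_interedges_eq_sum_degreeIn, card_interedges_eq_sum_degreeIn, ← sum_add_distrib]
    exact sum_const_nat fun a ha => (degreeIn_add_degreeIn_sdiff hQA a).trans (hdeg a ha)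
  have := two_mul_card_le_card_interedges_add_two hconn
  lia

lemma sum_nonneg_of_forall_component {M : Type*} [AddCommMonoid M] [PartialOrder M]
    [IsOrderedAddMonoid M] (g : V → M)
    (h : ∀ Q ⊆ T, (G.induce (Q : Set V)).Connected →
      (∀ a ∈ Q, neighborsIn G T a ⊆ Q) → 0 ≤ ∑ a ∈ Q, g a) :
    0 ≤ ∑ a ∈ T, g a := by
  classical
  set H : SimpleGraph V := (G.induce (T : Set V)).spanningCoe with hH
  have adj_iff (a b : V) : H.Adj a b ↔ a ∈ T ∧ b ∈ T ∧ G.Adj a b := by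
    simp [hH, SimpleGraph.map_adj]
    tauto
  have mem_of_reachable {a b : V} (hab : H.Reachable a b) (hb : b ∈ T) : a ∈ T := by
    obtain ⟨p⟩ := hab
    cases p with
    | nil => exact hb
    | cons hac _ => exact ((adj_iff _ _).1 hac).1
  rw [← sum_fiberwise_of_maps_to (t := T.image H.connectedComponentMk)
    (g := H.connectedComponentMk) fun _ => mem_image_of_mem _]
  refine sum_nonneg fun c hc => ?_
  obtain ⟨v, hv, rfl⟩ := mem_image.1 hc
  have supp_eq : (({a ∈ T | H.connectedComponentMk a = H.connectedComponentMk v} : Finset V) :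
      Set V) = (H.connectedComponentMk v).supp := by
    ext a
    simpa using fun ha => mem_of_reachable ha hv
  refine h _ (filter_subset _ _) ?_ fun a ha b hb => ?_
  · rw [supp_eq]
    exact (H.connectedComponentMk v).connected_toSimpleGraph.mono
      fun a b hab => ((adj_iff _ _).1 hab).2.2
  · obtain ⟨haT, hav⟩ := mem_filter.1 ha
    obtain ⟨hbT, hab⟩ := mem_neighborsIn.1 hb
    refine mem_filter.2 ⟨hbT, ?_⟩
    rw [← hav]
    exact SimpleGraph.ConnectedComponent.sound ((adj_iff _ _).2 ⟨hbT, haT, hab.symm⟩).reachable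

/-! ### Potential -/

/-- Twice the potential of `S` in the graph `G` with vertex weights `w`; the factor two is there
because `G.interedges S S` contains every edge of `G[S]` in both directions. -/
def potential (G : SimpleGraph V) [DecidableRel G.Adj] (k : ℕ) (w : V → ℕ)
    (S : Finset V) : ℤ :=
  ∑ v ∈ S, (8 * (k : ℤ) - (k + 3) * ((w v : ℤ) - 1)) - (3 * k + 1) * #(G.interedges S S)

@[simp]
lemma potential_empty : potential G k w ∅ = 0 := by
  simp [potential]

lemma potential_submodular [DecidableEq V] (S T : Finset V) :
    potential G k w (S ∪ T) + potential G k w (S ∩ T) ≤ potential G k w S + potential G k w T := by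
  have sum_eq := sum_union_inter (s₁ := S) (s₂ := T)
    (f := fun v => 8 * (k : ℤ) - (k + 3) * ((w v : ℤ) - 1))
  have card_le : (#(G.interedges S S) + #(G.interedges T T) : ℤ) ≤
      #(G.interedges (S ∪ T) (S ∪ T)) + #(G.interedges (S ∩ T) (S ∩ T)) :=
    mod_cast card_interedges_supermodular S T
  have mul_le := mul_le_mul_of_nonneg_left card_le (by positivity : (0 : ℤ) ≤ 3 * k + 1)
  unfold potential
  linarith

lemma potential_insert [DecidableEq V] (hu : u ∉ T) :
    potential G k w (insert u T) = potential G k w T + 8 * k - (k + 3) * ((w u : ℤ) - 1)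
      - 2 * (3 * k + 1) * degreeIn G T u := by
  unfold potential
  rw [sum_insert hu, card_interedges_insert hu]
  push_cast
  ring

lemma potential_add (w' : V → ℕ) :
    potential G k (w + w') S = potential G k w S - (k + 3) * ∑ v ∈ S, w' v := by
  simp only [potential, Pi.add_apply]
  push_cast
  rw [mul_sum, sub_right_comm, ← sum_sub_distrib]
  congr 1
  exact sum_congr rfl fun v _ => by ring

lemma potential_add_single [DecidableEq V] (n : ℕ) :
    potential G k (w + Pi.single x n) S =
      potential G k w S - if x ∈ S then (k + 3 : ℤ) * n else 0 := by
  rw [potential_add, sum_pi_single']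
  split_ifs <;> simp

/-- Every nonempty subset of `A` has positive potential: the sparseness condition under which `A` is
shown to have a weighted `(𝓘, 𝓞ₖ)`-partition. -/
def HasPosPotential (G : SimpleGraph V) [DecidableRel G.Adj] (k : ℕ) (w : V → ℕ)
    (A : Finset V) : Prop :=
  ∀ S ⊆ A, S.Nonempty → 0 < potential G k w S

lemma HasPosPotential.mono (hA : HasPosPotential G k w A) (h : S ⊆ A) : HasPosPotential G k w S :=
  fun _ hT => hA _ (hT.trans h)

lemma HasPosPotential.potential_nonneg (hA : HasPosPotential G k w A) (hS : S ⊆ A) :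
    0 ≤ potential G k w S := by
  rcases S.eq_empty_or_nonempty with rfl | hne
  · simp
  · exact (hA S hS hne).le

/-! ### Weighted partitions -/

/-- A weighted `(𝓘, 𝓞ₖ)`-partition of `G[A]`: `none` marks the independent part, and the other
vertices carry a label constant along edges such that every label has total weight at most `k`.
A label may be shared by several components. -/
structure IsIOColoring (G : SimpleGraph V) (k : ℕ) (w : V → ℕ) (A : Finset V)
    (f : V → Option ℕ) : Prop where
  indep : ∀ a ∈ A, ∀ b ∈ A, G.Adj a b → f a = none → f b ≠ none
  label_eq : ∀ a ∈ A, ∀ b ∈ A, G.Adj a b → f a ≠ none → f b ≠ none → f a = f b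
  weight_le : ∀ i : ℕ, ∑ v ∈ A with f v = some i, w v ≤ k

/-- `G[A]` with vertex weights `w` has an `(𝓘, 𝓞ₖ)`-partition. -/
def IsIOColorable (G : SimpleGraph V) (k : ℕ) (w : V → ℕ) (A : Finset V) : Prop :=
  ∃ f, IsIOColoring G k w A f

omit [DecidableRel G.Adj] in
lemma IsIOColoring.mono_weight {w' : V → ℕ} (hf : IsIOColoring G k w' A f) (h : w ≤ w') :
    IsIOColoring G k w A f :=
  ⟨hf.indep, hf.label_eq, fun i => (sum_le_sum fun v _ => h v).trans (hf.weight_le i)⟩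

lemma IsIOColoring.isIOColorable_of_label [DecidableEq V] {j : ℕ}
    (hf : IsIOColoring G k w (A \ N) f)
    (hindep : ∀ a ∈ N \ P, ∀ b ∈ N \ P, ¬ G.Adj a b)
    (hnone : ∀ a ∈ N \ P, ∀ b ∈ neighborsIn G (A \ N) a, f b ≠ none)
    (hsome : ∀ a ∈ P, ∀ b ∈ neighborsIn G (A \ N) a, f b = none ∨ f b = some j)
    (hweight : ∑ v ∈ A \ N with f v = some j, w v + ∑ v ∈ P, w v ≤ k) :
    IsIOColorable G k w A := by
  set g : V → Option ℕ := fun v => if v ∈ P then some j else if v ∈ N then none else f v with hg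
  have ne_none : ∀ a ∈ N \ P, ∀ b ∈ A \ N, G.Adj a b → f b ≠ none :=
    fun a ha b hb hab => hnone a ha b (mem_neighborsIn.2 ⟨hb, hab⟩)
  have eq_none_or : ∀ a ∈ P, ∀ b ∈ A \ N, G.Adj a b → f b = none ∨ f b = some j :=
    fun a ha b hb hab => hsome a ha b (mem_neighborsIn.2 ⟨hb, hab⟩)
  refine ⟨g, ?_, ?_, ?_⟩
  · have := hf.indep
    grind [G.adj_comm]
  · have := hf.label_eq
    grind [G.adj_comm]
  · intro i
    by_cases hij : i = j
    · subst hij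
      have subset : {v ∈ A | g v = some i} ⊆ {v ∈ A \ N | f v = some i} ∪ P := by grind
      calc ∑ v ∈ A with g v = some i, w v
        _ ≤ ∑ v ∈ {v ∈ A \ N | f v = some i} ∪ P, w v := sum_le_sum_of_subset subset
        _ ≤ ∑ v ∈ A \ N with f v = some i, w v + ∑ v ∈ P, w v :=
          (Nat.le_add_right _ _).trans_eq sum_union_inter
        _ ≤ k := hweight
    · have subset : {v ∈ A | g v = some i} ⊆ {v ∈ A \ N | f v = some i} := by grind
      exact (sum_le_sum_of_subset subset).trans (hf.weight_le i)

lemma IsIOColoring.isIOColorable_of_new_label [DecidableEq V]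
    (hf : IsIOColoring G k w (A \ N) f)
    (hindep : ∀ a ∈ N \ P, ∀ b ∈ N \ P, ¬ G.Adj a b)
    (hnone : ∀ a ∈ N \ P, ∀ b ∈ neighborsIn G (A \ N) a, f b ≠ none)
    (hsome : ∀ a ∈ P, ∀ b ∈ neighborsIn G (A \ N) a, f b = none)
    (hweight : ∑ v ∈ P, w v ≤ k) :
    IsIOColorable G k w A := by
  obtain ⟨j, hj⟩ := Infinite.exists_notMem_finset ((A \ N).image fun v => (f v).getD 0)
  have unused : {v ∈ A \ N | f v = some j} = ∅ :=
    filter_eq_empty_iff.2 fun v hv hfv => hj (mem_image.2 ⟨v, hv, by simp [hfv]⟩)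
  exact hf.isIOColorable_of_label (j := j) hindep hnone
    (fun a ha b hb => .inl (hsome a ha b hb))
    (by simpa only [unused, sum_empty, zero_add] using hweight)

/-! ### Critical sets -/

/-- A set that has no weighted `(𝓘, 𝓞ₖ)`-partition, although all its proper subsets have one. -/
structure IsCritical (G : SimpleGraph V) (k : ℕ) (w : V → ℕ) (A : Finset V) : Prop where
  not_isIOColorable : ¬ IsIOColorable G k w A
  isIOColorable_of_ssubset : ∀ B ⊂ A, IsIOColorable G k w B

lemma exists_adj_eq_none [DecidableEq V] (hA : ¬ IsIOColorable G k w A)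
    (hf : IsIOColoring G k w (A \ {v}) f) :
    ∃ x ∈ neighborsIn G A v, f x = none := by
  by_contra! h
  refine hA (hf.isIOColorable_of_new_label (P := ∅) ?_ ?_ ?_ ?_)
  all_goals grind [mem_neighborsIn, G.irrefl]

lemma exists_adj_ne_none [DecidableEq V] (hA : ¬ IsIOColorable G k w A)
    (hf : IsIOColoring G k w (A \ {v}) f) (hv : w v ≤ k) : ∃ x ∈ neighborsIn G A v, f x ≠ none := by
  by_contra! h
  refine hA (hf.isIOColorable_of_new_label (P := {v}) ?_ ?_ ?_ ?_)
  all_goals grind [mem_neighborsIn, sum_singleton]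

lemma IsCritical.degreeIn_pos (hA : IsCritical G k w A) (hv : v ∈ A) : 0 < degreeIn G A v := by
  classical
  obtain ⟨f, hf⟩ := hA.isIOColorable_of_ssubset (A \ {v}) (by grind)
  obtain ⟨x, hx, -⟩ := exists_adj_eq_none hA.not_isIOColorable hf
  exact card_pos.2 ⟨x, hx⟩

lemma IsCritical.one_lt_degreeIn (hA : IsCritical G k w A) (hv : v ∈ A) (hw : w v ≤ k) :
    1 < degreeIn G A v := by
  classical
  obtain ⟨f, hf⟩ := hA.isIOColorable_of_ssubset (A \ {v}) (by grind)
  obtain ⟨x, hx, hfx⟩ := exists_adj_eq_none hA.not_isIOColorable hf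
  obtain ⟨y, hy, hfy⟩ := exists_adj_ne_none hA.not_isIOColorable hf hw
  exact one_lt_card.2 ⟨x, hx, y, hy, fun hxy => hfy (hxy ▸ hfx)⟩

/-- The vertices of `A` outside `Q` that have a neighbour in `Q`. -/
def outerBoundary [DecidableEq V] (G : SimpleGraph V) [DecidableRel G.Adj] (A Q : Finset V) :
    Finset V :=
  {b ∈ A \ Q | ∃ a ∈ Q, G.Adj a b}

lemma mem_outerBoundary [DecidableEq V] :
    v ∈ outerBoundary G A Q ↔ (v ∈ A ∧ v ∉ Q) ∧ ∃ a ∈ Q, G.Adj a v := by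
  rw [outerBoundary, mem_filter, mem_sdiff]

lemma exists_neighborsIn_eq_pair_of_mem_outerBoundary [DecidableEq V] (hQA : Q ⊆ A)
    (hu : u ∈ outerBoundary G A Q) (hdeg : degreeIn G A u = 2)
    (hv : v ∈ neighborsIn G (A \ Q) u) : ∃ q ∈ Q, neighborsIn G A u = {q, v} := by
  obtain ⟨q, hq, hqu⟩ := (mem_outerBoundary.1 hu).2
  obtain ⟨x, -, hx⟩ := exists_neighborsIn_eq_pair hdeg (mem_neighborsIn.2 ⟨hQA hq, hqu.symm⟩)
  have hvx : v = x := by grind [neighborsIn_sdiff]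
  exact ⟨q, hq, hvx ▸ hx⟩

/-- Delete `Q` and its outer boundary `Y`. In a colouring of the rest, a vertex of `Y` with a
labelled neighbour goes to the independent part, and all the other vertices of `Q ∪ Y` share one
new label. -/
lemma IsCritical.lt_weight_add_weight_outerBoundary [DecidableEq V] (hA : IsCritical G k w A)
    (hQA : Q ⊆ A) (hQ : Q.Nonempty) (hdeg : ∀ b ∈ outerBoundary G A Q, degreeIn G A b = 2) :
    k < ∑ a ∈ Q, w a + ∑ b ∈ outerBoundary G A Q, w b := by
  by_contra! hk
  set Y := outerBoundary G A Q
  have disjoint_Q_Y : Disjoint Q Y :=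
    disjoint_right.2 fun _ hy => (mem_outerBoundary.1 hy).1.2
  have Y_subset : Y ⊆ A := fun _ hy => (mem_outerBoundary.1 hy).1.1
  obtain ⟨f, hf⟩ := hA.isIOColorable_of_ssubset _
    (sdiff_ssubset (union_subset hQA Y_subset) (hQ.mono subset_union_left))
  set P := Q ∪ {y ∈ Y | ∀ b ∈ neighborsIn G (A \ (Q ∪ Y)) y, f b = none}
  have neighborsIn_eq : ∀ y ∈ (Q ∪ Y) \ P, ∃ q ∈ Q, ∃ c ∈ A \ (Q ∪ Y), f c ≠ none ∧
      neighborsIn G A y = {q, c} := by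
    intro y hy
    obtain ⟨hyY, c, hc, hfc⟩ : y ∈ Y ∧ ∃ c ∈ neighborsIn G (A \ (Q ∪ Y)) y, f c ≠ none := by grind
    obtain ⟨hcA, hyc⟩ := mem_neighborsIn.1 hc
    obtain ⟨q, hq, hqc⟩ := exists_neighborsIn_eq_pair_of_mem_outerBoundary hQA hyY (hdeg y hyY)
      (mem_neighborsIn.2 ⟨by grind, hyc⟩ : c ∈ neighborsIn G (A \ Q) y)
    exact ⟨q, hq, c, hcA, hfc, hqc⟩
  refine hA.not_isIOColorable (hf.isIOColorable_of_new_label (P := P) ?_ ?_ ?_ ?_)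
  · intro a ha b hb hab
    obtain ⟨q, hq, c, hc, -, hqc⟩ := neighborsIn_eq a ha
    have hb' : b ∈ neighborsIn G A a := mem_neighborsIn.2 ⟨by grind, hab⟩
    grind
  · intro a ha b hb
    obtain ⟨q, hq, c, -, hfc, hqc⟩ := neighborsIn_eq a ha
    have hbc : b = c := by grind [neighborsIn_sdiff]
    exact hbc ▸ hfc
  · intro a ha b hb
    rcases mem_union.1 ha with haQ | haY
    · obtain ⟨hbA, hab⟩ := mem_neighborsIn.1 hb
      have hbY : b ∈ Y := mem_outerBoundary.2 ⟨by grind, a, haQ, hab⟩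
      grind
    · exact (mem_filter.1 haY).2 b hb
  · calc ∑ a ∈ P, w a
      _ ≤ ∑ a ∈ Q ∪ Y, w a := sum_le_sum_of_subset (by grind)
      _ = ∑ a ∈ Q, w a + ∑ b ∈ Y, w b := sum_union disjoint_Q_Y
      _ ≤ k := hk

/-! ### Adjacent vertices of degree two -/

lemma IsIOColoring.isIOColorable_of_pair [DecidableEq V]
    (hu : neighborsIn G A u = {v, x}) (hv : neighborsIn G A v = {u, z}) (hxv : x ≠ v)
    (hk : w u + w v ≤ k)
    (hf : IsIOColoring G k (w + Pi.single x (w u)) (A \ {u, v}) f) :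
    IsIOColorable G k w A := by
  have hf' : IsIOColoring G k w (A \ {u, v}) f := hf.mono_weight le_self_add
  obtain ⟨-, huv⟩ : v ∈ A ∧ G.Adj u v := mem_neighborsIn.1 (by simp [hu])
  obtain ⟨hxA, hux⟩ : x ∈ A ∧ G.Adj u x := mem_neighborsIn.1 (by simp [hu])
  have huv_ne := huv.ne
  have eq_x : ∀ b ∈ neighborsIn G (A \ {u, v}) u, b = x := by
    rw [neighborsIn_sdiff, hu]
    grind
  have eq_z : ∀ b ∈ neighborsIn G (A \ {u, v}) v, b = z := by
    rw [neighborsIn_sdiff, hv]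
    grind
  have not_adj_self (a : V) : ¬ G.Adj a a := G.irrefl
  rcases hfx : f x with _ | j <;> rcases hfz : f z with _ | i
  · refine hf'.isIOColorable_of_new_label (P := {u, v}) ?_ ?_ ?_ ?_
    all_goals grind [sum_pair]
  · refine hf'.isIOColorable_of_new_label (P := {u}) ?_ ?_ ?_ ?_
    all_goals grind [sum_singleton]
  · refine hf'.isIOColorable_of_new_label (P := {v}) ?_ ?_ ?_ ?_
    all_goals grind [sum_singleton]
  · have weight_le := hf.weight_le j
    have hx : x ∈ {a ∈ A \ {u, v} | f a = some j} := by grind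
    simp only [Pi.add_apply, sum_add_distrib, sum_pi_single', if_pos hx] at weight_le
    refine hf'.isIOColorable_of_label (P := {u}) (j := j) ?_ ?_ ?_ ?_
    all_goals grind [sum_singleton]

lemma isIOColorable_of_pair_of_lt_potential [DecidableEq V]
    (hB : ∀ w' : V → ℕ, (∀ v, 1 ≤ w' v) → HasPosPotential G k w' (A \ {u, v}) →
      IsIOColorable G k w' (A \ {u, v}))
    (hw : ∀ v, 1 ≤ w v) (hA : HasPosPotential G k w A)
    (hu : neighborsIn G A u = {v, x}) (hv : neighborsIn G A v = {u, z}) (hxv : x ≠ v)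
    (hk : w u + w v ≤ k)
    (hx : ∀ S ⊆ A \ {u, v}, x ∈ S → (k + 3) * w u < potential G k w S) :
    IsIOColorable G k w A := by
  have hasPosPotential : HasPosPotential G k (w + Pi.single x (w u)) (A \ {u, v}) := by
    intro S hS hne
    rw [potential_add_single]
    split_ifs with hxS
    · exact sub_pos.2 (hx S hS hxS)
    · simpa only [sub_zero] using hA S (hS.trans sdiff_subset) hne
  obtain ⟨f, hf⟩ := hB _ (fun a => (hw a).trans (Nat.le_add_right _ _)) hasPosPotential
  exact hf.isIOColorable_of_pair hu hv hxv hk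

lemma isIOColorable_of_adj_of_degreeIn_eq_two [DecidableEq V]
    (hB : ∀ w' : V → ℕ, (∀ v, 1 ≤ w' v) → HasPosPotential G k w' (A \ {u, v}) →
      IsIOColorable G k w' (A \ {u, v}))
    (hw : ∀ v, 1 ≤ w v) (hA : HasPosPotential G k w A) (huA : u ∈ A) (hvA : v ∈ A)
    (huv : G.Adj u v) (hdu : degreeIn G A u = 2) (hdv : degreeIn G A v = 2)
    (hk : w u + w v ≤ k) : IsIOColorable G k w A := by
  obtain ⟨x, hxv, hu⟩ := exists_neighborsIn_eq_pair hdu (mem_neighborsIn.2 ⟨hvA, huv⟩)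
  obtain ⟨z, hzu, hv⟩ := exists_neighborsIn_eq_pair hdv (mem_neighborsIn.2 ⟨huA, huv.symm⟩)
  have hux : G.Adj u x := (mem_neighborsIn.1 (by simp [hu] : x ∈ neighborsIn G A u)).2
  have hvz : G.Adj v z := (mem_neighborsIn.1 (by simp [hv] : z ∈ neighborsIn G A v)).2
  by_contra hcol
  obtain ⟨S, hS, hxS, potential_S_le⟩ :
      ∃ S ⊆ A \ {u, v}, x ∈ S ∧ potential G k w S ≤ (k + 3) * w u := by
    by_contra! h
    exact hcol (isIOColorable_of_pair_of_lt_potential hB hw hA hu hv hxv hk h)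
  obtain ⟨T, hT, hzT, potential_T_le⟩ :
      ∃ T ⊆ A \ {u, v}, z ∈ T ∧ potential G k w T ≤ (k + 3) * w v := by
    by_contra! h
    rw [pair_comm] at hB h
    exact hcol (isIOColorable_of_pair_of_lt_potential hB hw hA hv hu hzu (by lia) h)
  have hv_notMem : v ∉ S ∪ T := by grind
  have hu_notMem : u ∉ insert v (S ∪ T) := by grind [huv.ne]
  have degreeIn_v : 1 ≤ degreeIn G (S ∪ T) v :=
    card_pos.2 ⟨z, mem_neighborsIn.2 ⟨mem_union_right _ hzT, hvz⟩⟩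
  have degreeIn_u : 2 ≤ degreeIn G (insert v (S ∪ T)) u :=
    one_lt_card.2 ⟨x, mem_neighborsIn.2 ⟨by grind, hux⟩, v, mem_neighborsIn.2 ⟨by grind, huv⟩, hxv⟩
  have potential_pos : 0 < potential G k w (insert u (insert v (S ∪ T))) :=
    hA _ (by grind) (insert_nonempty _ _)
  have inter_nonneg : 0 ≤ potential G k w (S ∩ T) := hA.potential_nonneg (by grind)
  have submodular := potential_submodular (G := G) (k := k) (w := w) S T
  rw [potential_insert hu_notMem, potential_insert hv_notMem] at potential_pos
  zify at degreeIn_u degreeIn_v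
  linarith [mul_le_mul_of_nonneg_left degreeIn_v (by positivity : (0 : ℤ) ≤ 3 * k + 1),
    mul_le_mul_of_nonneg_left degreeIn_u (by positivity : (0 : ℤ) ≤ 3 * k + 1)]

/-! ### Discharging -/

/-- The initial charge of `a` in `G[A]`: the part of `-potential G k w A` that comes from `a` and
the half-edges at `a`. -/
def charge (G : SimpleGraph V) [DecidableRel G.Adj] (k : ℕ) (w : V → ℕ) (A : Finset V) (a : V) :
    ℤ :=
  (3 * k + 1) * degreeIn G A a - (8 * k - (k + 3) * ((w a : ℤ) - 1))

/-- Twice the charge that a vertex `a` whose degree in `G[A]` is not three keeps for each of its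
half-edges; it may be negative, and then the other end of the edge pays. -/
def halfEdgeCharge (G : SimpleGraph V) [DecidableRel G.Adj] (k : ℕ) (w : V → ℕ) (A : Finset V)
    (a : V) : ℤ :=
  if degreeIn G A a = 2 then (k + 3) * w a - (3 * k + 1) else 2 * ((k : ℤ) - 1)

lemma sum_charge : ∑ a ∈ A, charge G k w A a = -potential G k w A := by
  simp only [charge, potential, card_interedges_eq_sum_degreeIn, sum_sub_distrib, ← mul_sum]
  push_cast
  ring

lemma two_mul_charge_of_degreeIn_eq_three (h : degreeIn G A v = 3) :
    2 * charge G k w A v = 2 * (k + 3) * w v := by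
  rw [charge, h]
  push_cast
  ring

lemma degreeIn_mul_halfEdgeCharge_le (hk : 1 ≤ k) (hw : 1 ≤ w v) (hpos : 0 < degreeIn G A v)
    (hone : w v ≤ k → 1 < degreeIn G A v) (hthree : degreeIn G A v ≠ 3) :
    degreeIn G A v * halfEdgeCharge G k w A v ≤ 2 * charge G k w A v := by
  unfold halfEdgeCharge charge
  split_ifs with htwo
  · rw [htwo]
    push_cast
    linarith
  zify at hk hw
  obtain hd | hd : degreeIn G A v = 1 ∨ 4 ≤ degreeIn G A v := by lia
  · have weight_gt : (k + 1 : ℤ) ≤ w v := by lia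
    have : (0 : ℤ) ≤ (k - 1) * (k - 2) := by
      obtain rfl | hk' : k = 1 ∨ 2 ≤ k := by lia
      · simp
      · exact mul_nonneg (by lia) (by lia)
    rw [hd]
    push_cast
    nlinarith
  · zify at hd
    nlinarith

lemma halfEdgeCharge_add_halfEdgeCharge_nonneg (hk : 1 ≤ k) (hu : 1 ≤ w u) (hv : 1 ≤ w v)
    (htwo : degreeIn G A u = 2 → degreeIn G A v = 2 → k < w u + w v) :
    0 ≤ halfEdgeCharge G k w A u + halfEdgeCharge G k w A v := by
  unfold halfEdgeCharge
  zify at hk hu hv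
  split_ifs with hdu hdv hdv
  · have weight_gt := htwo hdu hdv
    zify at weight_gt
    nlinarith [sq_nonneg ((k : ℤ) - 1)]
  · nlinarith
  · nlinarith
  · linarith

lemma sum_degreeIn_mul_nonneg {σ : V → ℤ}
    (h : ∀ a ∈ S, ∀ b ∈ S, G.Adj a b → 0 ≤ σ a + σ b) :
    0 ≤ ∑ a ∈ S, degreeIn G S a * σ a := by
  have sum_left : ∑ a ∈ S, ∑ _b ∈ neighborsIn G S a, σ a = ∑ a ∈ S, degreeIn G S a * σ a := by
    simp only [sum_const, nsmul_eq_mul, degreeIn]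
  have two_mul_eq : 2 * ∑ a ∈ S, degreeIn G S a * σ a =
      ∑ a ∈ S, ∑ b ∈ neighborsIn G S a, (σ a + σ b) := by
    simp only [sum_add_distrib]
    rw [sum_neighborsIn_comm S S fun _ b => σ b, sum_left, two_mul]
  have : 0 ≤ ∑ a ∈ S, ∑ b ∈ neighborsIn G S a, (σ a + σ b) :=
    sum_nonneg fun a ha => sum_nonneg fun b hb =>
      h a ha b (mem_neighborsIn.1 hb).1 (mem_neighborsIn.1 hb).2
  linarith

lemma sum_sdiff_degreeIn_mul [DecidableEq V] {R : Type*} [Semiring R] (h : T ⊆ A) (σ : V → R) :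
    ∑ a ∈ A \ T, degreeIn G A a * σ a =
      ∑ a ∈ T, ∑ b ∈ neighborsIn G (A \ T) a, σ b + ∑ a ∈ A \ T, degreeIn G (A \ T) a * σ a := by
  rw [sum_neighborsIn_comm T (A \ T) fun _ b => σ b, ← sum_add_distrib]
  refine sum_congr rfl fun a _ => ?_
  rw [sum_const, nsmul_eq_mul, ← degreeIn, ← add_mul, ← degreeIn_add_degreeIn_sdiff h a,
    Nat.cast_add]

lemma sum_halfEdgeCharge (D : Finset (V × V)) :
    ∑ p ∈ D, halfEdgeCharge G k w A p.2 =
      (k + 3) * ∑ p ∈ D with degreeIn G A p.2 = 2, (w p.2 : ℤ) -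
        (3 * k + 1) * #{p ∈ D | degreeIn G A p.2 = 2} +
        2 * (k - 1) * #{p ∈ D | degreeIn G A p.2 ≠ 2} := by
  simp only [halfEdgeCharge, sum_ite, sum_sub_distrib, sum_const, nsmul_eq_mul, ← mul_sum]
  ring

/-- Here `O` is the weight of a component of the graph of vertices of degree three, `t` and `β` are
the numbers of edges from it to vertices of degree two and to the other vertices, and `M` is the
total weight of the ends of the first `t` of these edges. -/
lemma component_charge_nonneg {k O M t β : ℤ} (hk : 1 ≤ k) (hO : 0 ≤ O) (hβ : 0 ≤ β)
    (htβ : t + β ≤ O + 2) (htM : t ≤ M) (h : 1 ≤ β ∨ k + 1 ≤ O + M) :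
    0 ≤ 2 * (k + 3) * O + ((k + 3) * M - (3 * k + 1) * t + 2 * (k - 1) * β) := by
  have hk' : 0 ≤ k - 1 := by linarith
  obtain hlarge | ⟨hsmall, hM⟩ :
      (1 ≤ β ∨ k - 1 ≤ 2 * O) ∨ 2 * O ≤ k - 1 ∧ k + 1 - O ≤ M := by lia
  · have nonneg : 0 ≤ 8 * O - 4 * (k - 1) + 4 * (k - 1) * β := by
      rcases hlarge with h | h <;> nlinarith
    calc 0
      _ ≤ 2 * (k + 3) * O + ((k + 3) * t - (3 * k + 1) * t + 2 * (k - 1) * β) := by nlinarith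
      _ ≤ 2 * (k + 3) * O + ((k + 3) * M - (3 * k + 1) * t + 2 * (k - 1) * β) := by gcongr
  · calc 0
      _ ≤ (k - 1) * (k - 1 - 2 * O) + 2 * (k - 1) * β := by
        have := mul_nonneg hk' (by linarith : 0 ≤ k - 1 - 2 * O)
        positivity
      _ = 2 * (k + 3) * O +
          ((k + 3) * (k + 1 - O) - (3 * k + 1) * (O + 2) + 2 * (k - 1) * β) := by ring
      _ ≤ 2 * (k + 3) * O + ((k + 3) * M - (3 * k + 1) * t + 2 * (k - 1) * β) := by
        gcongr
        linarith

lemma sum_outerBoundary_le_sum_interedges [DecidableEq V] :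
    ∑ b ∈ outerBoundary G A Q, w b ≤ ∑ p ∈ G.interedges Q (A \ Q), w p.2 := by
  have subset_image : outerBoundary G A Q ⊆ (G.interedges Q (A \ Q)).image Prod.snd := by
    intro b hb
    obtain ⟨hbA, a, ha, hab⟩ := mem_outerBoundary.1 hb
    exact mem_image.2 ⟨(a, b), G.mem_interedges_iff.2 ⟨ha, mem_sdiff.2 hbA, hab⟩, rfl⟩
  exact (sum_le_sum_of_subset subset_image).trans
    (sum_image_le_of_nonneg fun _ _ => Nat.zero_le _)

lemma IsCritical.sum_component_nonneg [DecidableEq V] (hk : 1 ≤ k) (hw : ∀ v, 1 ≤ w v)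
    (hA : IsCritical G k w A) (hQA : Q ⊆ A) (hconn : (G.induce (Q : Set V)).Connected)
    (hdeg : ∀ a ∈ Q, degreeIn G A a = 3) :
    0 ≤ ∑ a ∈ Q, (2 * (k + 3) * (w a : ℤ) +
      ∑ b ∈ neighborsIn G (A \ Q) a, halfEdgeCharge G k w A b) := by
  set D := G.interedges Q (A \ Q) with hD
  have card_D_le : #D ≤ ∑ a ∈ Q, w a + 2 := by
    have card_le_weight := card_nsmul_le_sum Q w 1 fun a _ => hw a
    rw [smul_eq_mul, mul_one] at card_le_weight
    have := card_interedges_sdiff_le hQA hconn hdeg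
    lia
  have card_split := card_filter_add_card_filter_not (s := D) fun p => degreeIn G A p.2 = 2
  have card_le_weight :
      #{p ∈ D | degreeIn G A p.2 = 2} ≤ ∑ p ∈ D with degreeIn G A p.2 = 2, w p.2 := by
    simpa only [smul_eq_mul, mul_one] using
      card_nsmul_le_sum _ (fun p : V × V => w p.2) 1 fun p _ => hw p.2
  have card_pos_or : 1 ≤ #{p ∈ D | degreeIn G A p.2 ≠ 2} ∨
      k + 1 ≤ ∑ a ∈ Q, w a + ∑ p ∈ D with degreeIn G A p.2 = 2, w p.2 := by
    by_cases hD_two : ∀ p ∈ D, degreeIn G A p.2 = 2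
    · have weight_gt := hA.lt_weight_add_weight_outerBoundary hQA
        (nonempty_coe_sort.1 hconn.nonempty) fun b hb => by
          obtain ⟨hbA, a, ha, hab⟩ := mem_outerBoundary.1 hb
          exact hD_two (a, b) (G.mem_interedges_iff.2 ⟨ha, mem_sdiff.2 hbA, hab⟩)
      have := sum_outerBoundary_le_sum_interedges (G := G) (w := w) (A := A) (Q := Q)
      rw [filter_true_of_mem hD_two]
      lia
    · push Not at hD_two
      obtain ⟨p, hp, hdp⟩ := hD_two
      exact .inl (card_pos.2 ⟨p, mem_filter.2 ⟨hp, hdp⟩⟩)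
  rw [sum_add_distrib, ← mul_sum, ← sum_interedges Q _ fun _ b => halfEdgeCharge G k w A b,
    sum_halfEdgeCharge]
  zify at *
  exact component_charge_nonneg hk (by positivity) (by positivity) (by lia) card_le_weight
    card_pos_or

theorem IsCritical.potential_nonpos (hk : 1 ≤ k) (hw : ∀ v, 1 ≤ w v) (hA : IsCritical G k w A)
    (hpair : ∀ u ∈ A, ∀ v ∈ A, G.Adj u v → degreeIn G A u = 2 → degreeIn G A v = 2 →
      k < w u + w v) :
    potential G k w A ≤ 0 := by
  classical
  set σ := halfEdgeCharge G k w A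
  set T : Finset V := {a ∈ A | degreeIn G A a = 3}
  have hTA : T ⊆ A := filter_subset _ _
  have sum_T_nonneg :
      0 ≤ ∑ a ∈ T, (2 * (k + 3) * (w a : ℤ) + ∑ b ∈ neighborsIn G (A \ T) a, σ b) := by
    refine sum_nonneg_of_forall_component (G := G) _ fun Q hQT hconn hclosed => ?_
    have neighborsIn_eq : ∀ a ∈ Q, neighborsIn G (A \ T) a = neighborsIn G (A \ Q) a := by
      intro a ha
      have := hclosed a ha
      ext b
      grind [mem_neighborsIn]
    rw [sum_congr rfl fun a ha => by rw [neighborsIn_eq a ha]]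
    exact hA.sum_component_nonneg hk hw (hQT.trans hTA) hconn
      fun a ha => (mem_filter.1 (hQT ha)).2
  have sum_sdiff_nonneg : 0 ≤ ∑ a ∈ A \ T, degreeIn G (A \ T) a * σ a :=
    sum_degreeIn_mul_nonneg fun a ha b hb hab =>
      halfEdgeCharge_add_halfEdgeCharge_nonneg hk (hw a) (hw b)
        (hpair a (sdiff_subset ha) b (sdiff_subset hb) hab)
  have sum_T_charge : ∑ a ∈ T, 2 * (k + 3) * (w a : ℤ) = ∑ a ∈ T, 2 * charge G k w A a :=
    sum_congr rfl fun a ha => (two_mul_charge_of_degreeIn_eq_three (mem_filter.1 ha).2).symm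
  have sum_sdiff_charge :
      ∑ a ∈ A \ T, degreeIn G A a * σ a ≤ ∑ a ∈ A \ T, 2 * charge G k w A a := by
    refine sum_le_sum fun a ha => ?_
    obtain ⟨haA, haT⟩ := mem_sdiff.1 ha
    exact degreeIn_mul_halfEdgeCharge_le hk (hw a) (hA.degreeIn_pos haA) (hA.one_lt_degreeIn haA)
      fun h => haT (mem_filter.2 ⟨haA, h⟩)
  have sum_charge_nonneg : 0 ≤ 2 * ∑ a ∈ A, charge G k w A a := by
    rw [mul_sum, ← sum_sdiff hTA]
    rw [sum_add_distrib] at sum_T_nonneg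
    linarith [sum_sdiff_degreeIn_mul (G := G) hTA σ]
  rw [sum_charge] at sum_charge_nonneg
  linarith

/-! ### The theorem for unit weights -/

lemma HasPosPotential.one_le (hA : HasPosPotential G k w A) (hv : v ∈ A) (hw : 1 ≤ w v) :
    1 ≤ k := by
  have potential_pos := hA {v} (singleton_subset_iff.2 hv) (singleton_nonempty v)
  rw [potential, sum_singleton] at potential_pos
  by_contra! hk
  obtain rfl : k = 0 := by lia
  push_cast at potential_pos
  lia

theorem HasPosPotential.isIOColorable (hw : ∀ v, 1 ≤ w v) (hA : HasPosPotential G k w A) :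
    IsIOColorable G k w A := by
  classical
  induction A using Finset.strongInduction generalizing w with
  | H A ih =>
    by_contra hcol
    obtain ⟨v, hv⟩ : A.Nonempty := by
      by_contra! rfl
      exact hcol ⟨fun _ => none, by simp, by simp, by simp⟩
    have one_le_k : 1 ≤ k := hA.one_le hv (hw v)
    have isCritical : IsCritical G k w A := ⟨hcol, fun B hB => ih B hB hw (hA.mono hB.subset)⟩
    refine (hA A subset_rfl ⟨v, hv⟩).not_ge (isCritical.potential_nonpos one_le_k hw ?_)
    intro a ha b hb hab hda hdb
    by_contra! hk
    exact hcol (isIOColorable_of_adj_of_degreeIn_eq_two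
      (fun w' hw' h => ih _ (by grind) hw' h) hw hA ha hb hab hda hdb hk)

omit [DecidableRel G.Adj] in
lemma IsIOColoring.admitsIOPartition [Fintype V] (hf : IsIOColoring G k 1 univ f) :
    G.AdmitsIOPartition k := by
  refine ⟨{v | f v = none}, {v | f v ≠ none}, Set.union_compl_self _, disjoint_compl_right, ?_, ?_⟩
  · rintro ⟨a, ha⟩ ⟨b, hb⟩ hab
    exact hf.indep a (mem_univ _) b (mem_univ _) hab ha hb
  · intro c
    obtain ⟨⟨v, hv⟩, rfl⟩ := c.exists_rep
    obtain ⟨i, hi⟩ := Option.ne_none_iff_exists'.1 hv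
    have eq_of_reachable (a b) (hab : (G.induce {v | f v ≠ none}).Reachable a b) : f a = f b := by
      obtain ⟨p⟩ := hab
      induction p with
      | nil => rfl
      | @cons a b _ hab _ ih =>
        exact (hf.label_eq _ (mem_univ _) _ (mem_univ _) hab a.2 b.2).trans ih
    have supp_subset :
        Subtype.val '' ((G.induce {v | f v ≠ none}).connectedComponentMk ⟨v, hv⟩).supp ⊆
          ({a | f a = some i} : Finset V) := by
      rintro _ ⟨a, ha, rfl⟩
      simpa [hi] using eq_of_reachable _ _ (SimpleGraph.ConnectedComponent.exact ha)
    calc ((G.induce {v | f v ≠ none}).connectedComponentMk ⟨v, hv⟩).supp.encard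
      _ = (Subtype.val '' ((G.induce {v | f v ≠ none}).connectedComponentMk ⟨v, hv⟩).supp).encard :=
        (Subtype.val_injective.encard_image _).symm
      _ ≤ #{a | f a = some i} := by
        rw [← Set.encard_coe_eq_coe_finsetCard]
        exact Set.encard_le_encard supp_subset
      _ ≤ k := by
        simpa using hf.weight_le i

omit [DecidableRel G.Adj] in
lemma two_mul_ncard_edgeSet_div_le_mad [Finite V] (H : G.Subgraph) (hH : H.verts.Nonempty) :
    2 * (H.edgeSet.ncard : ℝ) / H.verts.ncard ≤ G.mad := by
  have finite_range := Set.finite_range fun H : G.Subgraph =>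
    2 * (H.edgeSet.ncard : ℝ) / H.verts.ncard
  refine le_csSup (finite_range.subset ?_).bddAbove ⟨H, hH, rfl⟩
  rintro _ ⟨H, -, rfl⟩
  exact ⟨H, rfl⟩

omit [DecidableRel G.Adj] in
lemma ncard_edgeSet_induce_top (S : Set V) :
    ((⊤ : G.Subgraph).induce S).edgeSet.ncard = (G.induce S).edgeSet.ncard := by
  rw [← SimpleGraph.Subgraph.image_coe_edgeSet_coe,
    Set.ncard_image_of_injective _ (Sym2.map.injective Subtype.val_injective),
    SimpleGraph.induce_eq_coe_induce_top]
  rfl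

lemma card_interedges_div_le_mad [Finite V] (hS : S.Nonempty) :
    (#(G.interedges S S) : ℝ) / #S ≤ G.mad := by
  rw [card_interedges_eq_two_mul_ncard, ← ncard_edgeSet_induce_top, Nat.cast_mul, Nat.cast_ofNat]
  simpa using two_mul_ncard_edgeSet_div_le_mad ((⊤ : G.Subgraph).induce (S : Set V)) hS

lemma potential_one : potential G k 1 S = 8 * k * #S - (3 * k + 1) * #(G.interedges S S) := by
  simp [potential, mul_comm]

lemma hasPosPotential_of_mad_lt [Finite V] (hG : G.mad < 8 * (k : ℝ) / (3 * (k : ℝ) + 1)) :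
    HasPosPotential G k 1 A := by
  intro S _ hS
  have lt := (card_interedges_div_le_mad hS).trans_lt hG
  rw [div_lt_div_iff₀ (mod_cast hS.card_pos) (by positivity)] at lt
  rw [potential_one, sub_pos, mul_comm]
  exact mod_cast lt

end WeightedIOPartition

theorem mainTheorem3_general (k : ℕ) {V : Type*} [Finite V] (G : SimpleGraph V)
    (hG : G.mad < 8 * (k : ℝ) / (3 * (k : ℝ) + 1)) :
    G.AdmitsIOPartition k := by
  classical
  cases nonempty_fintype V
  obtain ⟨f, hf⟩ :=
    (WeightedIOPartition.hasPosPotential_of_mad_lt (A := Finset.univ) hG).isIOColorable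
      fun _ => le_rfl
  exact hf.admitsIOPartition

theorem mainTheorem3 (k : ℕ) (hk : 2 ≤ k) {V : Type*} [Finite V] (G : SimpleGraph V)
    (hG : G.mad < 8 * (k : ℝ) / (3 * (k : ℝ) + 1)) :
    G.AdmitsIOPartition k :=
  mainTheorem3_general k G hG
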